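/- Let $\mathcal H$ be a real separable infinite-dimensional Hilbert space and let $\mathrm{HS}(\mathcal H)$ be the Hilbert–Schmidt operators on $\mathcal H$, with $\langle A,B\rangle_{\mathrm{HS}}=\mathrm{trace}(A^*B)$. Put $\mathrm{HS}_X(\mathcal H)=\{A+\gamma I: A\in\mathrm{HS}(\mathcal H),\ \gamma\in\mathbb R\}$ with the extended Hilbert–Schmidt inner product $\langle A+\gamma I,B+\mu I\rangle_{\mathrm{HS}_X}=\langle A,B\rangle_{\mathrm{HS}}+\gamma\mu$ and the norm $\|T\|_{\mathrm{HS}_X}=\langle T,T\rangle_{\mathrm{HS}_X}^{1/2}$. Let $\mathit{PC}_2(\mathcal H)$ be the set of operators $A+\gamma I$ with $A=A^*\in\mathrm{HS}(\mathcal H)$, $\gamma\in\mathbb R$, that are positive definite, i.e. $\langle x,(A+\gamma I)x\rangle\ge M\|x\|^2$ for all $x\in\mathcal H$ and some $M>0$. For $P=\sum_k\lambda_k\,\phi_k\otimes\phi_k\in\mathit{PC}_2(\mathcal H)$, with $(\phi_k)$ an orthonormal basis of eigenvectors, let $\log P=\sum_k\log(\lambda_k)\,\phi_k\otimes\phi_k$.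 For $P,Q\in\mathit{PC}_2(\mathcal H)$ put $P\odot Q=\exp(\log P+\log Q)$, $\langle P,Q\rangle_{\mathrm{logHS}}=\langle\log P,\log Q\rangle_{\mathrm{HS}_X}$ and $\|P\|_{\mathrm{logHS}}=\langle P,P\rangle_{\mathrm{logHS}}^{1/2}$. These objects are well defined: every $P\in\mathit{PC}_2(\mathcal H)$ has a unique bounded logarithm as above, $\log P$ is of the form $A+\gamma I$ with $A=A^*\in\mathrm{HS}(\mathcal H)$ and $\gamma\in\mathbb R$, $P$ is invertible with $P^{-1}\in\mathit{PC}_2(\mathcal H)$, and $P\odot Q\in\mathit{PC}_2(\mathcal H)$ for all $P,Q\in\mathit{PC}_2(\mathcal H)$. The following kernels $K:\mathit{PC}_2(\mathcal H)\times\mathit{PC}_2(\mathcal H)\to\mathbb R$ are positive definite, i.e. symmetric with $\sum_{j,k=1}^N c_jc_kK(P_j,P_k)\ge 0$ for all $N\in\mathbb N$, $P_1,\dots,P_N\in\mathit{PC}_2(\mathcal H)$, $c_1,\dots,c_N\in\mathbb R$: $$K(P,Q)=\bigl(\langle P,Q\rangle_{\mathrm{logHS}}+c\bigr)^d=\bigl(c+\langle\log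 P,\log Q\rangle_{\mathrm{HS}_X}\bigr)^d,\qquad c\ge 0,\ d\in\mathbb N=\{0,1,2,\dots\}$$ (a zeroth power being $1$), and $$K(P,Q)=\exp\Bigl(-\frac{\|P\odot Q^{-1}\|_{\mathrm{logHS}}^p}{\sigma^2}\Bigr)=\exp\Bigl(-\frac{\|\log P-\log Q\|_{\mathrm{HS}_X}^p}{\sigma^2}\Bigr),\qquad \sigma\neq 0,\ 0<p\le 2;$$ the equality of the two expressions for each kernel is part of the claim. -/

import Mathlib

open scoped InnerProductSpace

noncomputable section

namespace LogHS

/-- A real kernel on `X` is positive definite: it is symmetric and all the quadratic forms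
`∑ c_j c_k K(x_j, x_k)` are nonnegative. -/
def IsPosDefKernel {X : Type*} (K : X → X → ℝ) : Prop :=
  (∀ x y, K x y = K y x) ∧
    ∀ (N : ℕ) (x : Fin N → X) (c : Fin N → ℝ), 0 ≤ ∑ j, ∑ k, c j * c k * K (x j) (x k)

section Operators

set_option linter.unusedSectionVars false

variable {H : Type*} [NormedAddCommGroup H] [InnerProductSpace ℝ H] [CompleteSpace H]

variable (H) in
/-- The index set of a fixed orthonormal basis of `H`. -/
def basisIndex : Set H := (exists_hilbertBasis ℝ H).choose

variable (H) in
/-- A fixed orthonormal basis of `H`. Nothing below depends on the choice, see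
`isHilbertSchmidt_iff` and `hasSum_hsInner`. -/
def stdBasis : HilbertBasis (basisIndex H) ℝ H := (exists_hilbertBasis ℝ H).choose_spec.choose

/-- Hilbert–Schmidt operators: `∑ ‖A e_k‖² < ∞`. -/
def IsHilbertSchmidt (A : H →L[ℝ] H) : Prop := Summable fun k => ‖A (stdBasis H k)‖ ^ 2

/-- The trace `∑ ⟨e_k, T e_k⟩`; it is only used for `T = A* B` with `A`, `B` Hilbert–Schmidt. -/
def opTrace (T : H →L[ℝ] H) : ℝ := ∑' k, ⟪stdBasis H k, T (stdBasis H k)⟫_ℝ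

/-- The Hilbert–Schmidt inner product `⟨A, B⟩_HS = opTrace (A* B)`. -/
def hsInner (A B : H →L[ℝ] H) : ℝ := opTrace (ContinuousLinearMap.adjoint A ∘L B)

variable (H) in
/-- The extended (unitized) Hilbert–Schmidt operators `A + γ I`. -/
def HSX : Set (H →L[ℝ] H) :=
  {T | ∃ (A : H →L[ℝ] H) (γ : ℝ), IsHilbertSchmidt A ∧ T = A + γ • 1}

variable (H) in
/-- The operators `A + γ I` with `A` self-adjoint and Hilbert–Schmidt. -/
def SymHSX : Set (H →L[ℝ] H) :=
  {T | ∃ (A : H →L[ℝ] H) (γ : ℝ), IsSelfAdjoint A ∧ IsHilbertSchmidt A ∧ T = A + γ • 1}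

open Classical in
/-- The scalar `γ` in the decomposition `T = A + γ I` of an extended Hilbert–Schmidt operator;
it is unique when `H` is infinite-dimensional, see `scalarPart_eq`. -/
def scalarPart (T : H →L[ℝ] H) : ℝ :=
  if h : ∃ γ : ℝ, IsHilbertSchmidt (T - γ • (1 : H →L[ℝ] H)) then h.choose else 0

/-- The Hilbert–Schmidt part `A` in the decomposition `T = A + γ I`. -/
def hsPart (T : H →L[ℝ] H) : H →L[ℝ] H := T - scalarPart T • 1

/-- The extended Hilbert–Schmidt inner product
`⟨A + γ I, B + μ I⟩_{HS_X} = ⟨A, B⟩_HS + γ μ`, see `hsxInner_eq`. -/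
def hsxInner (S T : H →L[ℝ] H) : ℝ :=
  hsInner (hsPart S) (hsPart T) + scalarPart S * scalarPart T

/-- The extended Hilbert–Schmidt norm. -/
def hsxNorm (T : H →L[ℝ] H) : ℝ := √(hsxInner T T)

/-- Positive definite operators: self-adjoint with `⟨x, P x⟩ ≥ M ‖x‖²` for some `M > 0`. -/
def IsPosDefOp (P : H →L[ℝ] H) : Prop :=
  IsSelfAdjoint P ∧ ∃ M : ℝ, 0 < M ∧ ∀ x, M * ‖x‖ ^ 2 ≤ ⟪x, P x⟫_ℝ

variable (H) in
/-- The unitized positive definite Hilbert–Schmidt operators. -/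
def PC2 : Set (H →L[ℝ] H) :=
  {P | (∃ (A : H →L[ℝ] H) (γ : ℝ), IsSelfAdjoint A ∧ IsHilbertSchmidt A ∧ P = A + γ • 1) ∧
    IsPosDefOp P}

/-- `L` is the principal logarithm of `P`: for some orthonormal basis `φ` of eigenvectors of `P`
with positive eigenvalues `l`, one has `P = ∑ l_k φ_k ⊗ φ_k` and `L = ∑ log (l_k) φ_k ⊗ φ_k`.
There is at most one such bounded `L`, see `IsPrincipalLog.unique`. -/
def IsPrincipalLog (P L : H →L[ℝ] H) : Prop :=
  ∃ (w : Set H) (φ : HilbertBasis w ℝ H) (l : w → ℝ),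
    ∀ k, 0 < l k ∧ P (φ k) = l k • φ k ∧ L (φ k) = Real.log (l k) • φ k

open Classical in
/-- The principal logarithm of `P` (and `0` if `P` has none). -/
def opLog (P : H →L[ℝ] H) : H →L[ℝ] H :=
  if h : ∃ L, IsPrincipalLog P L then h.choose else 0

/-- The group operation `P ⊙ Q = exp (log P + log Q)`. -/
def odot (P Q : H →L[ℝ] H) : H →L[ℝ] H := NormedSpace.exp (opLog P + opLog Q)

/-- The Log-Hilbert–Schmidt inner product. -/
def logHSInner (P Q : H →L[ℝ] H) : ℝ := hsxInner (opLog P) (opLog Q)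

/-- The Log-Hilbert–Schmidt norm. -/
def logHSNorm (P : H →L[ℝ] H) : ℝ := √(logHSInner P P)

/-! ### The definitions do not depend on the choices -/

theorem parseval {ι : Type*} (g : HilbertBasis ι ℝ H) (x : H) :
    ENNReal.ofReal (‖x‖ ^ 2) = ∑' i, ENNReal.ofReal (⟪g i, x⟫_ℝ ^ 2) := by
  have h := g.hasSum_inner_mul_inner x x
  rw [real_inner_self_eq_norm_sq] at h
  have h' : HasSum (fun i => ⟪g i, x⟫_ℝ ^ 2) (‖x‖ ^ 2) := by
    refine h.congr_fun ?_
    intro i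
    rw [real_inner_comm x (g i), sq]
  rw [← h'.tsum_eq, ENNReal.ofReal_tsum_of_nonneg (fun i => sq_nonneg _) h'.summable]

theorem tsum_norm_sq_adjoint {ι κ : Type*} (e : HilbertBasis ι ℝ H) (f : HilbertBasis κ ℝ H)
    (A : H →L[ℝ] H) :
    ∑' k, ENNReal.ofReal (‖A (e k)‖ ^ 2) =
      ∑' j, ENNReal.ofReal (‖ContinuousLinearMap.adjoint A (f j)‖ ^ 2) := by
  simp_rw [parseval f (A _), parseval e (ContinuousLinearMap.adjoint A _)]
  rw [ENNReal.tsum_comm]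
  simp_rw [ContinuousLinearMap.adjoint_inner_right, real_inner_comm]

theorem tsum_norm_sq_eq {ι κ : Type*} (e : HilbertBasis ι ℝ H) (f : HilbertBasis κ ℝ H)
    (A : H →L[ℝ] H) :
    ∑' k, ENNReal.ofReal (‖A (e k)‖ ^ 2) = ∑' j, ENNReal.ofReal (‖A (f j)‖ ^ 2) := by
  rw [tsum_norm_sq_adjoint e f, ← tsum_norm_sq_adjoint f f]

theorem summable_iff_tsum_ne_top {ι : Type*} {g : ι → ℝ} (hg : ∀ i, 0 ≤ g i) :
    Summable g ↔ ∑' i, ENNReal.ofReal (g i) ≠ ⊤ := by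
  refine ⟨fun h => h.tsum_ofReal_ne_top, fun h => ?_⟩
  refine (ENNReal.summable_toReal h).congr fun i => ?_
  rw [ENNReal.toReal_ofReal (hg i)]

/-- The Hilbert–Schmidt property may be tested on any orthonormal basis. -/
theorem isHilbertSchmidt_iff {ι : Type*} (e : HilbertBasis ι ℝ H) (A : H →L[ℝ] H) :
    IsHilbertSchmidt A ↔ Summable fun k => ‖A (e k)‖ ^ 2 := by
  rw [IsHilbertSchmidt, summable_iff_tsum_ne_top (fun _ => sq_nonneg _),
    summable_iff_tsum_ne_top (fun _ => sq_nonneg _), tsum_norm_sq_eq (stdBasis H) e]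

theorem IsHilbertSchmidt.hasSum {ι : Type*} {A : H →L[ℝ] H} (hA : IsHilbertSchmidt A)
    (e : HilbertBasis ι ℝ H) :
    HasSum (fun k => ‖A (e k)‖ ^ 2) (∑' k, ‖A (stdBasis H k)‖ ^ 2) := by
  have h := (isHilbertSchmidt_iff e A).1 hA
  convert h.hasSum using 1
  have h1 := ENNReal.ofReal_tsum_of_nonneg (fun _ => sq_nonneg _) h
  have h2 := ENNReal.ofReal_tsum_of_nonneg (fun _ => sq_nonneg _) hA
  rw [tsum_norm_sq_eq e (stdBasis H), ← h2] at h1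
  exact ((ENNReal.ofReal_eq_ofReal_iff (tsum_nonneg fun _ => sq_nonneg _)
    (tsum_nonneg fun _ => sq_nonneg _)).1 h1).symm

theorem IsHilbertSchmidt.add {A B : H →L[ℝ] H} (hA : IsHilbertSchmidt A)
    (hB : IsHilbertSchmidt B) : IsHilbertSchmidt (A + B) := by
  refine Summable.of_nonneg_of_le (fun _ => sq_nonneg _) (fun k => ?_)
    ((Summable.mul_left 2 hA).add (Summable.mul_left 2 hB))
  have h1 := norm_add_le (A (stdBasis H k)) (B (stdBasis H k))
  have h2 := norm_nonneg (A (stdBasis H k) + B (stdBasis H k))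
  simp only [add_apply]
  nlinarith [sq_nonneg (‖A (stdBasis H k)‖ - ‖B (stdBasis H k)‖)]

theorem IsHilbertSchmidt.smul {A : H →L[ℝ] H} (hA : IsHilbertSchmidt A) (c : ℝ) :
    IsHilbertSchmidt (c • A) := by
  refine (Summable.mul_left (c ^ 2) hA).congr fun k => ?_
  simp [norm_smul, mul_pow]

theorem IsHilbertSchmidt.sub {A B : H →L[ℝ] H} (hA : IsHilbertSchmidt A)
    (hB : IsHilbertSchmidt B) : IsHilbertSchmidt (A - B) := by
  simpa [sub_eq_add_neg] using hA.add (hB.smul (-1))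

theorem hasSum_inner_polarization {ι : Type*} (e : HilbertBasis ι ℝ H) {A B : H →L[ℝ] H}
    (hA : IsHilbertSchmidt A) (hB : IsHilbertSchmidt B) :
    HasSum (fun k => ⟪A (e k), B (e k)⟫_ℝ) ((1 / 4 : ℝ) *
      (∑' k, ‖(A + B) (stdBasis H k)‖ ^ 2 - ∑' k, ‖(A - B) (stdBasis H k)‖ ^ 2)) := by
  refine ((((hA.add hB).hasSum e).sub ((hA.sub hB).hasSum e)).mul_left (1 / 4 : ℝ)).congr_fun ?_
  intro k
  simp only [add_apply, sub_apply]
  rw [norm_add_sq_real, norm_sub_sq_real]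
  ring

/-- The Hilbert–Schmidt inner product may be computed in any orthonormal basis, by an
absolutely convergent series. -/
theorem hasSum_hsInner {ι : Type*} (e : HilbertBasis ι ℝ H) {A B : H →L[ℝ] H}
    (hA : IsHilbertSchmidt A) (hB : IsHilbertSchmidt B) :
    HasSum (fun k => ⟪A (e k), B (e k)⟫_ℝ) (hsInner A B) := by
  have key := hasSum_inner_polarization e hA hB
  have h1 := (hasSum_inner_polarization (stdBasis H) hA hB).tsum_eq
  have h2 : hsInner A B = ∑' k, ⟪A (stdBasis H k), B (stdBasis H k)⟫_ℝ := by
    simp [hsInner, opTrace, ContinuousLinearMap.adjoint_inner_right]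
  rwa [h2, h1]

/-- The identity of an infinite-dimensional space is not Hilbert–Schmidt. -/
theorem not_isHilbertSchmidt_smul_one (hH : ¬ FiniteDimensional ℝ H) {c : ℝ}
    (h : IsHilbertSchmidt (c • (1 : H →L[ℝ] H))) : c = 0 := by
  by_contra hc
  apply hH
  have h1 : Summable fun _ : basisIndex H => c ^ 2 := by
    refine h.congr fun k => ?_
    simp [norm_smul, (stdBasis H).orthonormal.1 k]
  have h2 : Finite (basisIndex H) := by
    by_contra h3
    rw [not_finite_iff_infinite] at h3
    exact pow_ne_zero 2 hc ((summable_const_iff _).1 h1)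
  have := Fintype.ofFinite (basisIndex H)
  exact ((stdBasis H).toOrthonormalBasis).toBasis.finiteDimensional_of_finite

/-- The decomposition of an extended Hilbert–Schmidt operator is unique. -/
theorem scalarPart_eq (hH : ¬ FiniteDimensional ℝ H) {A : H →L[ℝ] H} (hA : IsHilbertSchmidt A)
    (γ : ℝ) : scalarPart (A + γ • (1 : H →L[ℝ] H)) = γ := by
  have h : ∃ μ : ℝ, IsHilbertSchmidt (A + γ • (1 : H →L[ℝ] H) - μ • (1 : H →L[ℝ] H)) :=
    ⟨γ, by simpa using hA⟩
  rw [scalarPart, dif_pos h]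
  have h1 := h.choose_spec.sub hA
  have h2 : A + γ • (1 : H →L[ℝ] H) - h.choose • (1 : H →L[ℝ] H) - A
      = (γ - h.choose) • (1 : H →L[ℝ] H) := by
    rw [sub_smul]; abel
  rw [h2] at h1
  exact (sub_eq_zero.1 (not_isHilbertSchmidt_smul_one hH h1)).symm

theorem hsPart_eq (hH : ¬ FiniteDimensional ℝ H) {A : H →L[ℝ] H} (hA : IsHilbertSchmidt A)
    (γ : ℝ) : hsPart (A + γ • (1 : H →L[ℝ] H)) = A := by
  simp [hsPart, scalarPart_eq hH hA]

theorem hsxInner_eq (hH : ¬ FiniteDimensional ℝ H) {A B : H →L[ℝ] H} (hA : IsHilbertSchmidt A)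
    (hB : IsHilbertSchmidt B) (γ μ : ℝ) :
    hsxInner (A + γ • (1 : H →L[ℝ] H)) (B + μ • (1 : H →L[ℝ] H)) = hsInner A B + γ * μ := by
  simp [hsxInner, scalarPart_eq hH, hsPart_eq hH, hA, hB]

/-- A principal logarithm acts as `log c` on every eigenvector of eigenvalue `c`. -/
theorem IsPrincipalLog.apply_eq {P L : H →L[ℝ] H} (h : IsPrincipalLog P L) {x : H} {c : ℝ}
    (hx : P x = c • x) : L x = Real.log c • x := by
  obtain ⟨w, φ, l, hl⟩ := h
  have h1 : HasSum (fun k => (l k * φ.repr x k) • φ k) (P x) := by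
    refine (P.hasSum (φ.hasSum_repr x)).congr_fun fun k => ?_
    simp [(hl k).2.1, smul_smul, mul_comm]
  have h2 : HasSum (fun k => (Real.log (l k) * φ.repr x k) • φ k) (L x) := by
    refine (L.hasSum (φ.hasSum_repr x)).congr_fun fun k => ?_
    simp [(hl k).2.2, smul_smul, mul_comm]
  have h3 : ∀ k, c * φ.repr x k = l k * φ.repr x k := by
    intro k
    have h4 : HasSum (fun j => ⟪φ k, (l j * φ.repr x j) • φ j⟫_ℝ) ⟪φ k, P x⟫_ℝ :=
      (innerSL ℝ (φ k)).hasSum h1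
    have h5 := h4.unique (hasSum_single k fun j hj => by
      rw [inner_smul_right, φ.orthonormal.2 hj.symm, mul_zero])
    rw [inner_smul_right, real_inner_self_eq_norm_sq, φ.orthonormal.1 k, hx, inner_smul_right,
      ← φ.repr_apply_apply] at h5
    simpa using h5
  refine h2.unique ?_
  refine ((φ.hasSum_repr x).const_smul (Real.log c)).congr_fun fun k => ?_
  rw [smul_smul]
  by_cases h0 : φ.repr x k = 0
  · simp [h0]
  · rw [mul_right_cancel₀ h0 (h3 k)]

theorem IsPrincipalLog.unique {P L L' : H →L[ℝ] H} (h : IsPrincipalLog P L)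
    (h' : IsPrincipalLog P L') : L = L' := by
  obtain ⟨w, φ, l, hl⟩ := id h'
  refine ContinuousLinearMap.ext_on (s := Set.range φ) ?_ ?_
  · have := φ.dense_span
    exact (Submodule.dense_iff_topologicalClosure_eq_top).2 this
  · rintro _ ⟨k, rfl⟩
    rw [h.apply_eq (hl k).2.1, (hl k).2.2]

theorem IsPrincipalLog.opLog_eq {P L : H →L[ℝ] H} (h : IsPrincipalLog P L) : opLog P = L := by
  have h' : ∃ L, IsPrincipalLog P L := ⟨L, h⟩
  rw [opLog, dif_pos h']
  exact h'.choose_spec.unique h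

end Operators

end LogHS

end

open LogHS

/-! The map `opLog` turns both kernels into functions of the inner product on `SymHSX`, so
everything follows from one kernel, K(P,Q) = ⟨log P, log Q⟩, which is positive definite as a sum of
inner-product kernels and a rank-one kernel. Polynomials in K with nonnegative coefficients stay
positive definite by the Schur product theorem.

For the Gaussian family let ψ(x,y) = K(x,x) + K(y,y) - 2K(x,y) be the squared distance. Then
exp(-tψ) equals f(x)f(y)exp(2tK), which settles p = 2. For p < 2 put a = p/2: the power ψ^a is a
positive mixture over s > 0 of the functions 1 - exp(-sψ), so ψ^a centered at a base point is
positive definite (`center_sqDist_rpow`), and exponentiating as for p = 2 gives the claim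
(`exp_neg_sqDist_rpow`).

The operator side is diagonal. A self-adjoint Hilbert–Schmidt operator is compact and has an
eigenbasis, on which log, inverse and exp act on the eigenvalues. Each is Lipschitz on the range
concerned, so the eigenvalues stay square-summably close to a scalar. Hence log P ⊙ Q⁻¹ = log P -
log Q. -/

namespace LogHS

/-! ### Closure properties of positive definite kernels -/

namespace IsPosDefKernel

variable {X : Type*} {K K' : X → X → ℝ}

theorem posSemidef (h : IsPosDefKernel K) {N : ℕ} (x : Fin N → X) :
    (Matrix.of fun j k => K (x j) (x k)).PosSemidef := by
  refine Matrix.posSemidef_iff_dotProduct_mulVec.2 ⟨?_, fun c => ?_⟩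
  · ext j k
    simp [h.1 (x j) (x k)]
  · refine (h.2 N x c).trans_eq ?_
    simp only [dotProduct, Matrix.mulVec, Finset.mul_sum, Pi.star_apply, star_trivial,
      Matrix.of_apply]
    exact Finset.sum_congr rfl fun j _ => Finset.sum_congr rfl fun k _ => by ring

theorem of_posSemidef (h : ∀ (N : ℕ) (x : Fin N → X),
    (Matrix.of fun j k => K (x j) (x k)).PosSemidef) : IsPosDefKernel K := by
  refine ⟨fun a b => ?_, fun N x c => ?_⟩
  -- Two points suffice for symmetry: it is the off-diagonal entry of a Hermitian 2 × 2 matrix.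
  · simpa using ((h 2 ![a, b]).isHermitian.apply 0 1).symm
  · refine ((Matrix.posSemidef_iff_dotProduct_mulVec.1 (h N x)).2 c).trans_eq ?_
    simp only [dotProduct, Matrix.mulVec, Finset.mul_sum, Pi.star_apply, star_trivial,
      Matrix.of_apply]
    exact Finset.sum_congr rfl fun j _ => Finset.sum_congr rfl fun k _ => by ring

/-- The Schur product theorem for kernels. -/
theorem mul (h : IsPosDefKernel K) (h' : IsPosDefKernel K') :
    IsPosDefKernel fun x y => K x y * K' x y :=
  of_posSemidef fun _ x => (h.posSemidef x).hadamard (h'.posSemidef x)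

theorem add (h : IsPosDefKernel K) (h' : IsPosDefKernel K') :
    IsPosDefKernel fun x y => K x y + K' x y :=
  of_posSemidef fun _ x => (h.posSemidef x).add (h'.posSemidef x)

theorem of_factor (f : X → ℝ) : IsPosDefKernel fun x y => f x * f y := by
  refine ⟨fun x y => mul_comm _ _, fun N x c => ?_⟩
  refine (mul_self_nonneg (∑ j, c j * f (x j))).trans_eq ?_
  rw [Finset.sum_mul_sum]
  exact Finset.sum_congr rfl fun j _ => Finset.sum_congr rfl fun k _ => by ring

theorem const {c : ℝ} (hc : 0 ≤ c) : IsPosDefKernel fun _ _ : X => c := by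
  simpa [Real.mul_self_sqrt hc] using of_factor fun _ : X => √c

theorem pow (h : IsPosDefKernel K) (n : ℕ) : IsPosDefKernel fun x y => K x y ^ n := by
  induction n with
  | zero => simpa using const zero_le_one
  | succ n ih => simpa only [pow_succ] using ih.mul h

theorem sum {ι : Type*} {F : ι → X → X → ℝ} (h : ∀ i, IsPosDefKernel (F i)) (s : Finset ι) :
    IsPosDefKernel fun x y => ∑ i ∈ s, F i x y := by
  classical
  induction s using Finset.induction_on with
  | empty => simpa using const le_rfl
  | insert i s hi ih => simpa only [Finset.sum_insert hi] using (h i).add ih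

/-- Each quadratic form involves finitely many kernel values, so its nonnegativity survives
pointwise limits. -/
theorem of_tendsto {ι : Type*} {l : Filter ι} [l.NeBot] {F : ι → X → X → ℝ}
    (h : ∀ i, IsPosDefKernel (F i))
    (hF : ∀ x y, Filter.Tendsto (fun i => F i x y) l (nhds (K x y))) : IsPosDefKernel K := by
  refine ⟨fun x y => ?_, fun N x c => ?_⟩
  · refine tendsto_nhds_unique (hF x y) ?_
    simpa only [(h _).1 x y] using hF y x
  · refine ge_of_tendsto' (tendsto_finsetSum _ fun j _ => tendsto_finsetSum _ fun k _ =>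
      (hF (x j) (x k)).const_mul (c j * c k)) fun i => (h i).2 N x c

theorem of_hasSum {ι : Type*} {F : ι → X → X → ℝ} (h : ∀ i, IsPosDefKernel (F i))
    (hF : ∀ x y, HasSum (fun i => F i x y) (K x y)) : IsPosDefKernel K :=
  of_tendsto (sum h) hF

/-- The exponential series has nonnegative coefficients, and powers are covered by the Schur
product. -/
theorem exp (h : IsPosDefKernel K) : IsPosDefKernel fun x y => Real.exp (K x y) := by
  refine of_hasSum (F := fun n x y => K x y ^ n * (n.factorial : ℝ)⁻¹)
    (fun n => (h.pow n).mul (const (by positivity))) fun x y => ?_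
  simpa [Real.exp_eq_exp_ℝ, div_eq_mul_inv] using NormedSpace.expSeries_div_hasSum_exp (K x y)

theorem of_inner {E : Type*} [NormedAddCommGroup E] [InnerProductSpace ℝ E] (f : X → E) :
    IsPosDefKernel fun x y => ⟪f x, f y⟫_ℝ := by
  refine ⟨fun x y => real_inner_comm _ _, fun N x c => ?_⟩
  refine (real_inner_self_nonneg (x := ∑ j, c j • f (x j))).trans_eq ?_
  simp only [sum_inner, inner_sum, real_inner_smul_left, real_inner_smul_right, mul_assoc]
  exact Finset.sum_congr rfl fun j _ => Finset.sum_congr rfl fun k _ => by rw [real_inner_comm]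

theorem comp {Y : Type*} (h : IsPosDefKernel K) (f : Y → X) :
    IsPosDefKernel fun x y => K (f x) (f y) :=
  ⟨fun _ _ => h.1 _ _, fun N x c => h.2 N (fun i => f (x i)) c⟩

/-- Recentering a positive definite kernel at a base point. -/
theorem center (h : IsPosDefKernel K) (o : X) :
    IsPosDefKernel fun x y => K x y - K x o - K o y + K o o := by
  refine ⟨fun x y => ?_, fun N x c => ?_⟩
  · simp only [h.1 x y, h.1 x o, h.1 o y]
    ring
  -- Adjoining `o` with weight minus the sum of the others produces exactly the three correction
  -- terms.
  · refine (h.2 (N + 1) (Fin.cons o x) (Fin.cons (-∑ j, c j) c)).trans_eq ?_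
    simp only [Fin.sum_univ_succ, Fin.cons_zero, Fin.cons_succ, mul_add, mul_sub,
      Finset.sum_add_distrib, Finset.sum_sub_distrib]
    simp only [← Finset.sum_mul, ← Finset.mul_sum, mul_assoc, mul_neg, neg_mul,
      Finset.sum_neg_distrib]
    simp only [mul_left_comm _ (∑ j, c j) , ← Finset.mul_sum]
    ring

/-- The squared distance induced by a kernel is nonnegative. -/
theorem sqDist_nonneg (h : IsPosDefKernel K) (x y : X) : 0 ≤ K x x + K y y - 2 * K x y := by
  have h1 := h.2 2 ![x, y] ![1, -1]
  simp only [Fin.sum_univ_two, Matrix.cons_val_zero, Matrix.cons_val_one] at h1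
  linarith [h.1 x y]

/-- The Gaussian kernel of the squared distance induced by a positive definite kernel. -/
theorem exp_neg_sqDist (h : IsPosDefKernel K) {t : ℝ} (ht : 0 ≤ t) :
    IsPosDefKernel fun x y => Real.exp (-(t * (K x x + K y y - 2 * K x y))) := by
  have h1 := ((const (X := X) (mul_nonneg zero_le_two ht)).mul h).exp
  -- The diagonal terms split off as a rank-one factor, leaving exp(2tK).
  convert (of_factor fun x => Real.exp (-(t * K x x))).mul h1 using 3 with x y
  rw [← Real.exp_add, ← Real.exp_add]
  ring_nf

end IsPosDefKernel

/-! ### Fractional powers as mixtures of exponentials -/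

section BernsteinRepresentation

open MeasureTheory Set

/-- Near 0 the bound 1 - e^(-u) ≤ u leaves x s^(-a), integrable since a < 1; on (1, ∞) the bound
s^(-1-a) is integrable since a > 0. -/
theorem integrableOn_one_sub_exp_mul_rpow {a : ℝ} (ha : 0 < a) (ha' : a < 1) {x : ℝ}
    (hx : 0 ≤ x) :
    IntegrableOn (fun s : ℝ => (1 - Real.exp (-(x * s))) * s ^ (-1 - a)) (Ioi 0) := by
  have hm : ∀ S : Set ℝ, AEStronglyMeasurable
      (fun s : ℝ => (1 - Real.exp (-(x * s))) * s ^ (-1 - a)) (volume.restrict S) :=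
    fun S => Measurable.aestronglyMeasurable (by fun_prop)
  have h0 : ∀ s : ℝ, 0 < s → 0 ≤ 1 - Real.exp (-(x * s)) := fun s hs => by
    have : Real.exp (-(x * s)) ≤ 1 := Real.exp_le_one_iff.2 (by nlinarith)
    linarith
  rw [← Ioc_union_Ioi_eq_Ioi zero_le_one]
  refine IntegrableOn.union ?_ ?_
  · have h1 : IntegrableOn (fun s : ℝ => x * s ^ (-a)) (Ioc 0 1) :=
      ((intervalIntegrable_iff_integrableOn_Ioc_of_le zero_le_one).1
        (intervalIntegral.intervalIntegrable_rpow' (by linarith))).const_mul x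
    refine Integrable.mono' h1 (hm _) ?_
    filter_upwards [ae_restrict_mem measurableSet_Ioc] with s hs
    have hs0 : 0 < s := hs.1
    rw [Real.norm_of_nonneg (mul_nonneg (h0 s hs0) (Real.rpow_nonneg hs0.le _))]
    have h2 : s ^ (-a) = s * s ^ (-1 - a) := by
      rw [← Real.rpow_one_add' hs0.le (by linarith)]
      ring_nf
    rw [h2, ← mul_assoc]
    refine mul_le_mul_of_nonneg_right ?_ (Real.rpow_nonneg hs0.le _)
    linarith [Real.add_one_le_exp (-(x * s))]
  · refine Integrable.mono' (integrableOn_Ioi_rpow_of_lt (a := -1 - a) (by linarith) one_pos)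
      (hm _) ?_
    filter_upwards [ae_restrict_mem measurableSet_Ioi] with s hs
    have hs0 : 0 < s := zero_lt_one.trans hs
    rw [Real.norm_of_nonneg (mul_nonneg (h0 s hs0) (Real.rpow_nonneg hs0.le _))]
    refine mul_le_of_le_one_left (Real.rpow_nonneg hs0.le _) ?_
    linarith [Real.exp_pos (-(x * s))]

/-- Only the sign of the normalizing constant matters, as it is divided out later; its value is
never computed. -/
theorem integral_one_sub_exp_mul_rpow_pos {a : ℝ} (ha : 0 < a) (ha' : a < 1) :
    0 < ∫ s in Ioi (0 : ℝ), (1 - Real.exp (-s)) * s ^ (-1 - a) := by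
  have hpos : ∀ s ∈ Ioi (0 : ℝ), 0 < (1 - Real.exp (-s)) * s ^ (-1 - a) := fun s hs => by
    have : Real.exp (-s) < 1 := Real.exp_lt_one_iff.2 (neg_lt_zero.2 hs)
    exact mul_pos (by linarith) (Real.rpow_pos_of_pos hs _)
  rw [setIntegral_pos_iff_support_of_nonneg_ae]
  · have hsub : Ioi (0 : ℝ) ⊆ Function.support fun s : ℝ => (1 - Real.exp (-s)) * s ^ (-1 - a) :=
      fun s hs => (hpos s hs).ne'
    rw [inter_eq_self_of_subset_right hsub]
    simp
  · filter_upwards [ae_restrict_mem measurableSet_Ioi] with s hs using (hpos s hs).le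
  · simpa using integrableOn_one_sub_exp_mul_rpow ha ha' zero_le_one

/-- The Bernstein representation of the power `x ^ a` for `0 < a < 1`. -/
theorem integral_one_sub_exp_mul_rpow {a : ℝ} (ha : 0 < a) {x : ℝ} (hx : 0 ≤ x) :
    ∫ s in Ioi (0 : ℝ), (1 - Real.exp (-(x * s))) * s ^ (-1 - a)
      = x ^ a * ∫ s in Ioi (0 : ℝ), (1 - Real.exp (-s)) * s ^ (-1 - a) := by
  rcases hx.eq_or_lt with rfl | hx
  · simp [Real.zero_rpow ha.ne']
  -- Rescaling s by x > 0 produces the factor x^a.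
  have h := integral_comp_mul_left_Ioi (fun s : ℝ => (1 - Real.exp (-s)) * s ^ (-1 - a)) 0 hx
  rw [mul_zero, smul_eq_mul] at h
  have h1 : x ^ a = x ^ (1 + a) * x⁻¹ := by
    rw [Real.rpow_add hx, Real.rpow_one]
    field_simp
  rw [h1, mul_assoc, ← h, ← integral_const_mul]
  refine setIntegral_congr_fun measurableSet_Ioi fun s hs => ?_
  have h2 : x ^ (1 + a) * x ^ (-1 - a) = 1 := by
    rw [← Real.rpow_add hx]
    simp
  rw [Real.mul_rpow hx.le (le_of_lt hs)]
  linear_combination (-(1 - Real.exp (-(x * s))) * s ^ (-1 - a)) * h2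

end BernsteinRepresentation

/-! ### Schoenberg's theorem for powers of the distance -/

namespace IsPosDefKernel

open MeasureTheory Set

variable {X : Type*} {K : X → X → ℝ}

/-- After the Bernstein representation, the integrand at s is s^(-1-a) times the Gaussian kernel
exp(-sψ) centered at `o`; the constants match because ψ(o,o) = 0. -/
theorem center_sqDist_rpow (h : IsPosDefKernel K) (o : X) {a : ℝ} (ha : 0 < a) (ha' : a < 1) :
    IsPosDefKernel fun x y => (K x x + K o o - 2 * K x o) ^ a + (K y y + K o o - 2 * K y o) ^ a
      - (K x x + K y y - 2 * K x y) ^ a := by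
  refine ⟨fun x y => ?_, fun N x c => ?_⟩
  · simp only [h.1 x y, add_comm (K x x) (K y y)]
    ring
  set ψ : X → X → ℝ := fun x y => K x x + K y y - 2 * K x y with hψ
  set C := ∫ s in Ioi (0 : ℝ), (1 - Real.exp (-s)) * s ^ (-1 - a) with hC
  have hCpos : 0 < C := integral_one_sub_exp_mul_rpow_pos ha ha'
  set g : ℝ → ℝ → ℝ := fun t s => (1 - Real.exp (-(t * s))) * s ^ (-1 - a) with hg
  have hgi : ∀ x y, IntegrableOn (g (ψ x y)) (Ioi 0) := fun x y =>
    integrableOn_one_sub_exp_mul_rpow ha ha' (h.sqDist_nonneg x y)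
  have hgv : ∀ x y, ∫ s in Ioi (0 : ℝ), g (ψ x y) s = ψ x y ^ a * C := fun x y =>
    integral_one_sub_exp_mul_rpow ha (h.sqDist_nonneg x y)
  have hψo : ψ o o = 0 := by simp only [hψ]; ring
  have hψs : ∀ x, ψ o x = ψ x o := fun x => by simp only [hψ, h.1 o x]; ring
  change 0 ≤ ∑ j, ∑ k, c j * c k * (ψ (x j) o ^ a + ψ (x k) o ^ a - ψ (x j) (x k) ^ a)
  have key : C * ∑ j, ∑ k, c j * c k * (ψ (x j) o ^ a + ψ (x k) o ^ a - ψ (x j) (x k) ^ a)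
      = ∫ s in Ioi (0 : ℝ), ∑ j, ∑ k, c j * c k *
        (g (ψ (x j) o) s + g (ψ (x k) o) s - g (ψ (x j) (x k)) s) := by
    have hi : ∀ j k, IntegrableOn (fun s => c j * c k *
        (g (ψ (x j) o) s + g (ψ (x k) o) s - g (ψ (x j) (x k)) s)) (Ioi 0) := fun j k =>
      (((hgi _ _).add (hgi _ _)).sub (hgi _ _)).const_mul _
    rw [integral_finsetSum _ fun j _ => integrable_finsetSum _ fun k _ => hi j k, Finset.mul_sum]
    refine Finset.sum_congr rfl fun j _ => ?_
    rw [integral_finsetSum _ fun k _ => hi j k, Finset.mul_sum]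
    refine Finset.sum_congr rfl fun k _ => ?_
    have hadd := integral_add (hgi (x j) o) (hgi (x k) o)
    have hsub := integral_sub ((hgi (x j) o).add (hgi (x k) o)) (hgi (x j) (x k))
    simp only [Pi.add_apply] at hsub
    rw [integral_const_mul, hsub, hadd, hgv, hgv, hgv]
    ring
  refine nonneg_of_mul_nonneg_right (key ▸ ?_) hCpos
  refine setIntegral_nonneg measurableSet_Ioi fun s hs => ?_
  have hs' : (0 : ℝ) < s := hs
  have h1 := (((h.exp_neg_sqDist hs'.le).center o).mul
    (const (Real.rpow_nonneg hs'.le (-1 - a)))).2 N x c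
  refine h1.trans_eq (Finset.sum_congr rfl fun j _ => Finset.sum_congr rfl fun k _ => ?_)
  change c j * c k * ((Real.exp (-(s * ψ (x j) (x k))) - Real.exp (-(s * ψ (x j) o))
    - Real.exp (-(s * ψ o (x k))) + Real.exp (-(s * ψ o o))) * s ^ (-1 - a)) = _
  simp only [hψo, hψs, mul_zero, neg_zero, Real.exp_zero]
  simp only [hg, mul_comm _ s]
  ring

/-- Schoenberg: the generalized Gaussian kernels `exp (-t ‖x - y‖ ^ (2 a))`, `0 < a ≤ 1`. -/
theorem exp_neg_sqDist_rpow [Nonempty X] (h : IsPosDefKernel K) {a t : ℝ} (ha : 0 < a)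
    (ha' : a ≤ 1) (ht : 0 ≤ t) :
    IsPosDefKernel fun x y => Real.exp (-(t * (K x x + K y y - 2 * K x y) ^ a)) := by
  -- The exponent 1 is separate because the Bernstein integral diverges there.
  rcases ha'.eq_or_lt with rfl | ha'
  · simpa using h.exp_neg_sqDist ht
  let o : X := Classical.arbitrary X
  have h1 := ((const (X := X) ht).mul (h.center_sqDist_rpow o ha ha')).exp
  convert (of_factor fun x => Real.exp (-(t * (K x x + K o o - 2 * K x o) ^ a))).mul h1
    using 3 with x y
  rw [← Real.exp_add, ← Real.exp_add]
  ring_nf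

end IsPosDefKernel

end LogHS

namespace LogHS

/-! ### Diagonalization and functions of diagonal operators -/

section EigenvectorBases

set_option linter.unusedSectionVars false

open Filter Topology

variable {H : Type*} [NormedAddCommGroup H] [InnerProductSpace ℝ H] [CompleteSpace H]
  {ι : Type*} (φ : HilbertBasis ι ℝ H)

theorem hasSum_inner_sq (x : H) : HasSum (fun i => ⟪φ i, x⟫_ℝ ^ 2) (‖x‖ ^ 2) := by
  rw [← real_inner_self_eq_norm_sq]
  refine (φ.hasSum_inner_mul_inner x x).congr_fun fun i => ?_
  rw [real_inner_comm x (φ i), sq]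

theorem ext_hilbertBasis {S T : H →L[ℝ] H} (h : ∀ i, S (φ i) = T (φ i)) : S = T :=
  ContinuousLinearMap.ext_on ((Submodule.dense_iff_topologicalClosure_eq_top).2 φ.dense_span)
    (by rintro _ ⟨i, rfl⟩; exact h i)

/-- Self-adjoint Hilbert–Schmidt operators are compact. -/
theorem IsHilbertSchmidt.isCompactOperator {A : H →L[ℝ] H} (hA : IsHilbertSchmidt A)
    (hs : IsSelfAdjoint A) : IsCompactOperator A := by
  classical
  set e := stdBasis H
  -- By self-adjointness ⟨A e_i, x⟩ = ⟨e_i, A x⟩, so `F s` is A followed by projection onto the span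
  -- of the e_i with i in s.
  let F : Finset (basisIndex H) → H →L[ℝ] H := fun s =>
    ∑ i ∈ s, (innerSL ℝ (A (e i))).smulRight (e i)
  have hFc : ∀ s, IsCompactOperator (F s) := fun s => by
    refine Submodule.sum_mem (compactOperator (RingHom.id ℝ) H H) fun i _ => ?_
    exact (isCompactOperator_of_locallyCompactSpace_rng
      (ContinuousLinearMap.toSpanSingleton ℝ (e i))).comp_clm (innerSL ℝ (A (e i)))
  have hsymm : ∀ x y, ⟪A x, y⟫_ℝ = ⟪x, A y⟫_ℝ := hs.isSymmetric
  have hinner : ∀ s x j, ⟪e j, (A - F s) x⟫_ℝ = if j ∈ s then 0 else ⟪A (e j), x⟫_ℝ := by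
    intro s x j
    have h1 : ⟪e j, F s x⟫_ℝ = if j ∈ s then ⟪A (e j), x⟫_ℝ else 0 := by
      simp only [F, sum_apply, ContinuousLinearMap.smulRight_apply, inner_sum,
        inner_smul_right, innerSL_apply_apply, orthonormal_iff_ite.1 e.orthonormal, mul_ite,
        mul_one, mul_zero, Finset.sum_ite_eq]
    rw [sub_apply, inner_sub_right, h1, ← hsymm]
    split_ifs <;> simp
  -- Parseval and Cauchy–Schwarz bound the error by the Hilbert–Schmidt tail outside s.
  have hbound : ∀ s, ‖F s - A‖ ≤ √(∑' j : {j // j ∉ s}, ‖A (e j)‖ ^ 2) := by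
    intro s
    rw [norm_sub_rev]
    refine ContinuousLinearMap.opNorm_le_bound _ (Real.sqrt_nonneg _) fun x => ?_
    rw [← Real.sqrt_sq (norm_nonneg x), ← Real.sqrt_mul (tsum_nonneg fun _ => sq_nonneg _)]
    refine Real.le_sqrt_of_sq_le ?_
    have hsub : Summable fun j : {j // j ∉ s} => ‖A (e j)‖ ^ 2 := hA.subtype _
    have h2 : HasSum (fun j : {j // j ∉ s} => ⟪A (e j), x⟫_ℝ ^ 2) (‖(A - F s) x‖ ^ 2) := by
      have h3 := hasSum_inner_sq e ((A - F s) x)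
      rw [← hasSum_subtype_iff_of_support_subset (s := {j | j ∉ s})] at h3
      · refine h3.congr_fun fun j => ?_
        have hj : (j : basisIndex H) ∉ s := j.2
        simp only [Function.comp_apply, hinner, if_neg hj]
      · intro j hj hjs
        simp only [Function.mem_support, hinner] at hj
        exact hj (by rw [if_pos hjs]; simp)
    refine hasSum_le (fun j => ?_) h2 (hsub.hasSum.mul_right _)
    rw [← mul_pow]
    exact sq_le_sq' (by linarith [neg_le_of_abs_le (abs_real_inner_le_norm (A (e j)) x)])
      (real_inner_le_norm _ _)
  refine isCompactOperator_of_tendsto (F := F) (l := atTop) ?_ (Eventually.of_forall hFc)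
  rw [tendsto_iff_norm_sub_tendsto_zero]
  refine squeeze_zero (fun _ => norm_nonneg _) hbound ?_
  simpa using (tendsto_tsum_compl_atTop_zero fun j => ‖A (e j)‖ ^ 2).sqrt

/-- Self-adjoint Hilbert–Schmidt operators have an orthonormal basis of eigenvectors. -/
theorem IsHilbertSchmidt.exists_eigenbasis {A : H →L[ℝ] H} (hA : IsHilbertSchmidt A)
    (hs : IsSelfAdjoint A) :
    ∃ (w : Set H) (φ : HilbertBasis w ℝ H) (a : w → ℝ), ∀ i, A (φ i) = a i • φ i := by
  have hsymm : (A : H →ₗ[ℝ] H).IsSymmetric := hs.isSymmetric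
  have hc := hA.isCompactOperator hs
  let V : ℝ → Submodule ℝ H := fun μ => Module.End.eigenspace (A : H →ₗ[ℝ] H) μ
  have hclosed : ∀ μ, CompleteSpace (V μ) := fun μ => by
    have : (V μ : Set H) = {x | A x = μ • x} := by
      ext x
      simp [V]
    refine IsClosed.completeSpace_coe (hs := ?_)
    rw [this]
    exact isClosed_eq A.continuous (continuous_const_smul μ)
  -- Orthonormal bases of all eigenspaces, kernel included, are joined; the compact spectral theorem
  -- makes the union complete.
  let v : (Σ μ, basisIndex (V μ)) → H := fun i => (stdBasis (V i.1) i.2 : H)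
  have hv : Orthonormal ℝ v :=
    hsymm.orthogonalFamily_eigenspaces.orthonormal_sigma_orthonormal
      fun μ => (stdBasis (V μ)).orthonormal
  have hAv : ∀ i, A (v i) = i.1 • v i := fun i =>
    Module.End.mem_eigenspace_iff.1 (stdBasis (V i.1) i.2).2
  have hv' : Orthonormal ℝ ((↑) : Set.range v → H) := hv.toSubtypeRange
  refine ⟨Set.range v, HilbertBasis.mkOfOrthogonalEqBot hv' ?_, fun i => i.2.choose.1, fun i => ?_⟩
  · rw [Subtype.range_coe, eq_bot_iff,
      ← ContinuousLinearMap.orthogonalComplement_iSup_eigenspaces_eq_bot hc hsymm]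
    intro x hx
    rw [← Submodule.iInf_orthogonal, Submodule.mem_iInf]
    intro μ
    rw [Submodule.mem_orthogonal]
    intro y hy
    have h1 := (innerSL ℝ x ∘L (V μ).subtypeL).hasSum ((stdBasis (V μ)).hasSum_repr ⟨y, hy⟩)
    have h2 : ∀ i, ⟪x, (stdBasis (V μ) i : H)⟫_ℝ = 0 := fun i => by
      rw [real_inner_comm]
      exact Submodule.inner_right_of_mem_orthogonal
        (Submodule.subset_span (Set.mem_range_self (⟨μ, i⟩ : Σ μ, basisIndex (V μ)))) hx
    rw [real_inner_comm]
    refine h1.unique (hasSum_zero.congr_fun fun i => ?_)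
    simp [h2]
  · rw [HilbertBasis.coe_mkOfOrthogonalEqBot]
    have := hAv i.2.choose
    rwa [i.2.choose_spec] at this

/-- The operator with prescribed bounded eigenvalues on an orthonormal basis. -/
theorem exists_diagonal {t : ι → ℝ} {C : ℝ} (ht : ∀ i, |t i| ≤ C) :
    ∃ T : H →L[ℝ] H, ∀ i, T (φ i) = t i • φ i := by
  classical
  have hle : ∀ (f : lp (fun _ : ι => ℝ) 2) i, ‖t i * f i‖ ^ 2 ≤ C ^ 2 * ‖f i‖ ^ 2 := fun f i => by
    rw [norm_mul, mul_pow]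
    exact mul_le_mul_of_nonneg_right (pow_le_pow_left₀ (norm_nonneg _) (ht i) 2) (sq_nonneg _)
  have hsum : ∀ f : lp (fun _ : ι => ℝ) 2, Summable fun i => ‖f i‖ ^ 2 := fun f => by
    simpa using (lp.memℓp f).summable (by norm_num)
  have hmem : ∀ f : lp (fun _ : ι => ℝ) 2, Memℓp (fun i => t i * f i) 2 := fun f => by
    refine memℓp_gen ?_
    simpa using Summable.of_nonneg_of_le (fun i => sq_nonneg _) (hle f) ((hsum f).mul_left _)
  -- Multiplication by t on ℓ², later transported to H along the basis.
  let D : lp (fun _ : ι => ℝ) 2 →ₗ[ℝ] lp (fun _ : ι => ℝ) 2 :=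
    { toFun := fun f => ⟨fun i => t i * f i, hmem f⟩
      map_add' := fun f g => by ext i; exact mul_add _ _ _
      map_smul' := fun c f => by ext i; exact mul_left_comm _ _ _ }
  let D' := D.mkContinuous |C| fun f => by
    refine lp.norm_le_of_forall_sum_le (by norm_num) (by positivity) fun s => ?_
    have h1 : ‖f‖ ^ 2 = ∑' i, ‖f i‖ ^ 2 := by
      simpa using lp.norm_rpow_eq_tsum (p := 2) (by norm_num) f
    simp only [ENNReal.toReal_ofNat, Real.rpow_ofNat]
    rw [mul_pow, sq_abs, h1, ← tsum_mul_left]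
    refine (Finset.sum_le_sum fun i _ => hle f i).trans ?_
    exact ((hsum f).mul_left _).sum_le_tsum s fun i _ => by positivity
  refine ⟨φ.repr.symm.toContinuousLinearEquiv.toContinuousLinearMap ∘L D' ∘L
    φ.repr.toContinuousLinearEquiv.toContinuousLinearMap, fun i => ?_⟩
  change φ.repr.symm (D (φ.repr (φ i))) = t i • φ i
  rw [LinearIsometryEquiv.symm_apply_eq, map_smul, φ.repr_self]
  ext j
  change t j * (lp.single 2 i (1 : ℝ) : ι → ℝ) j = t i * (lp.single 2 i (1 : ℝ) : ι → ℝ) j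
  rcases eq_or_ne j i with rfl | hj
  · rfl
  · simp [hj]

variable {φ} {T : H →L[ℝ] H} {t : ι → ℝ}

theorem hasSum_inner_diagonal (h : ∀ i, T (φ i) = t i • φ i) (x y : H) :
    HasSum (fun i => t i * (⟪φ i, x⟫_ℝ * ⟪φ i, y⟫_ℝ)) ⟪x, T y⟫_ℝ := by
  have h1 := (innerSL ℝ x).hasSum (T.hasSum (φ.hasSum_repr y))
  refine h1.congr_fun fun i => ?_
  simp only [map_smul, h, innerSL_apply_apply, smul_eq_mul, φ.repr_apply_apply,
    real_inner_comm x (φ i)]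
  ring

theorem isSelfAdjoint_of_diagonal (h : ∀ i, T (φ i) = t i • φ i) : IsSelfAdjoint T := by
  rw [ContinuousLinearMap.isSelfAdjoint_iff_isSymmetric]
  intro x y
  refine HasSum.unique ?_ (hasSum_inner_diagonal h x y)
  change HasSum _ ⟪T x, y⟫_ℝ
  rw [real_inner_comm]
  simpa only [mul_comm ⟪φ _, x⟫_ℝ] using hasSum_inner_diagonal h y x

theorem isPosDefOp_of_diagonal (h : ∀ i, T (φ i) = t i • φ i) {m : ℝ} (hm : 0 < m)
    (ht : ∀ i, m ≤ t i) : IsPosDefOp T := by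
  refine ⟨isSelfAdjoint_of_diagonal h, m, hm, fun x => ?_⟩
  refine hasSum_le (fun i => ?_) ((hasSum_inner_sq φ x).mul_left m) (hasSum_inner_diagonal h x x)
  rw [← sq]
  exact mul_le_mul_of_nonneg_right (ht i) (sq_nonneg _)

theorem mem_SymHSX_of_diagonal (h : ∀ i, T (φ i) = t i • φ i) {γ : ℝ}
    (ht : Summable fun i => (t i - γ) ^ 2) : T ∈ SymHSX H := by
  have h1 : ∀ i, (T - γ • (1 : H →L[ℝ] H)) (φ i) = (t i - γ) • φ i := fun i => by
    simp [h, sub_smul]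
  refine ⟨T - γ • 1, γ, isSelfAdjoint_of_diagonal h1, ?_, by simp⟩
  rw [isHilbertSchmidt_iff φ]
  refine ht.congr fun i => ?_
  rw [h1, norm_smul, φ.orthonormal.1 i, mul_one, Real.norm_eq_abs, sq_abs]

theorem exists_diagonal_of_mem_SymHSX {T : H →L[ℝ] H} (hT : T ∈ SymHSX H) :
    ∃ (w : Set H) (φ : HilbertBasis w ℝ H) (t : w → ℝ) (γ : ℝ),
      (∀ i, T (φ i) = t i • φ i) ∧ Summable fun i => (t i - γ) ^ 2 := by
  obtain ⟨A, γ, hs, hA, rfl⟩ := hT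
  obtain ⟨w, φ, a, ha⟩ := hA.exists_eigenbasis hs
  refine ⟨w, φ, fun i => a i + γ, γ, fun i => by simp [ha, add_smul], ?_⟩
  refine ((isHilbertSchmidt_iff φ A).1 hA).congr fun i => ?_
  rw [ha, norm_smul, φ.orthonormal.1 i, mul_one, Real.norm_eq_abs, sq_abs, add_sub_cancel_right]

theorem summable_sq_of_abs_le {f a : ι → ℝ} (ha : Summable fun i => a i ^ 2) {C : ℝ}
    (hf : ∀ i, |f i| ≤ C * |a i|) : Summable fun i => f i ^ 2 := by
  refine Summable.of_nonneg_of_le (fun i => sq_nonneg _) (fun i => ?_) (ha.mul_left (C ^ 2))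
  rw [← sq_abs (f i), ← sq_abs (a i), ← mul_pow]
  exact pow_le_pow_left₀ (abs_nonneg _) (hf i) 2

theorem exists_abs_le_of_summable_sq {a : ι → ℝ} (ha : Summable fun i => a i ^ 2) :
    ∃ R, ∀ i, |a i| ≤ R :=
  ⟨√(∑' i, a i ^ 2), fun i => Real.abs_le_sqrt (ha.le_tsum i fun _ _ => sq_nonneg _)⟩

/-- A function of a diagonal operator that is Lipschitz at the scalar part. -/
theorem exists_diagonal_comp (φ : HilbertBasis ι ℝ H) {γ : ℝ}
    (ht : Summable fun i => (t i - γ) ^ 2) (f : ℝ → ℝ) {C : ℝ}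
    (hf : ∀ i, |f (t i) - f γ| ≤ C * |t i - γ|) :
    ∃ S ∈ SymHSX H, ∀ i, S (φ i) = f (t i) • φ i := by
  have hsum := summable_sq_of_abs_le ht hf
  obtain ⟨R, hR⟩ := exists_abs_le_of_summable_sq hsum
  obtain ⟨S, hS⟩ := exists_diagonal φ (t := fun i => f (t i)) (C := R + |f γ|) fun i => by
    have := abs_add_le (f (t i) - f γ) (f γ)
    rw [sub_add_cancel] at this
    linarith [hR i]
  exact ⟨S, mem_SymHSX_of_diagonal hS hsum, hS⟩

/-- The exponential series is applied to x term by term. -/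
theorem exp_apply_eigenvector {T : H →L[ℝ] H} {x : H} {c : ℝ} (h : T x = c • x) :
    NormedSpace.exp T x = Real.exp c • x := by
  have hpow : ∀ n : ℕ, (T ^ n) x = c ^ n • x := fun n => by
    induction n with
    | zero => simp
    | succ n ih =>
      rw [pow_succ, mul_apply_eq_comp, h, map_smul, ih, smul_smul, mul_comm, pow_succ]
  have h1 := (ContinuousLinearMap.apply ℝ H x).hasSum
    (NormedSpace.exp_series_hasSum_exp' (𝕂 := ℝ) T)
  have h2 := (NormedSpace.exp_series_hasSum_exp' (𝕂 := ℝ) c).smul_const x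
  rw [← Real.exp_eq_exp_ℝ] at h2
  refine h1.unique (h2.congr_fun fun n => ?_)
  simp [hpow, smul_smul]

end EigenvectorBases

end LogHS

namespace LogHS

/-! ### The Log-Hilbert–Schmidt structure -/

section LogHilbertSchmidt

set_option linter.unusedSectionVars false

variable {H : Type*} [NormedAddCommGroup H] [InnerProductSpace ℝ H] [CompleteSpace H]

theorem add_mem_SymHSX {S T : H →L[ℝ] H} (hS : S ∈ SymHSX H) (hT : T ∈ SymHSX H) :
    S + T ∈ SymHSX H := by
  obtain ⟨A, γ, hA, hA', rfl⟩ := hS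
  obtain ⟨B, μ, hB, hB', rfl⟩ := hT
  exact ⟨A + B, γ + μ, hA.add hB, hA'.add hB', by rw [add_smul]; abel⟩

/-- The Hilbert–Schmidt part is the sum over basis vectors e_k of the kernels ⟨S e_k, T e_k⟩, and
the scalar part is a rank-one kernel. -/
theorem isPosDefKernel_hsxInner (hH : ¬ FiniteDimensional ℝ H) :
    IsPosDefKernel fun S T : SymHSX H => hsxInner (S : H →L[ℝ] H) T := by
  choose A γ hs hA hT using fun T : SymHSX H => T.2
  have h1 : IsPosDefKernel fun S T : SymHSX H => hsInner (A S) (A T) :=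
    IsPosDefKernel.of_hasSum (fun k => IsPosDefKernel.of_inner fun S => A S (stdBasis H k))
      fun S T => hasSum_hsInner (stdBasis H) (hA S) (hA T)
  convert h1.add (IsPosDefKernel.of_factor γ) using 3 with S T
  rw [hT S, hT T, hsxInner_eq hH (hA S) (hA T)]

theorem hsInner_sub_self {A B : H →L[ℝ] H} (hA : IsHilbertSchmidt A) (hB : IsHilbertSchmidt B) :
    hsInner (A - B) (A - B) = hsInner A A + hsInner B B - 2 * hsInner A B := by
  refine (hasSum_hsInner (stdBasis H) (hA.sub hB) (hA.sub hB)).unique ?_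
  refine (((hasSum_hsInner (stdBasis H) hA hA).add (hasSum_hsInner (stdBasis H) hB hB)).sub
    ((hasSum_hsInner (stdBasis H) hA hB).mul_left 2)).congr_fun fun k => ?_
  simp only [sub_apply, inner_sub_left, inner_sub_right, real_inner_comm (A _) (B _)]
  ring

theorem hsxNorm_sub (hH : ¬ FiniteDimensional ℝ H) {S T : H →L[ℝ] H} (hS : S ∈ SymHSX H)
    (hT : T ∈ SymHSX H) :
    hsxNorm (S - T) = √(hsxInner S S + hsxInner T T - 2 * hsxInner S T) := by
  obtain ⟨A, γ, -, hA, rfl⟩ := hS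
  obtain ⟨B, μ, -, hB, rfl⟩ := hT
  have h : A + γ • (1 : H →L[ℝ] H) - (B + μ • 1) = (A - B) + (γ - μ) • 1 := by
    rw [sub_smul]; abel
  rw [hsxNorm, h, hsxInner_eq hH (hA.sub hB) (hA.sub hB), hsxInner_eq hH hA hA,
    hsxInner_eq hH hB hB, hsxInner_eq hH hA hB, hsInner_sub_self hA hB]
  ring_nf

theorem infinite_of_hilbertBasis (hH : ¬ FiniteDimensional ℝ H) {ι : Type*}
    (φ : HilbertBasis ι ℝ H) : Infinite ι := by
  rw [← not_finite_iff_infinite]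
  intro h
  have := Fintype.ofFinite ι
  exact hH φ.toOrthonormalBasis.toBasis.finiteDimensional_of_finite

/-- Diagonalization of the elements of `PC2`; the eigenvalues and the scalar part are bounded
away from zero. -/
theorem exists_diagonal_of_mem_PC2 (hH : ¬ FiniteDimensional ℝ H) {P : H →L[ℝ] H}
    (hP : P ∈ PC2 H) :
    ∃ (w : Set H) (φ : HilbertBasis w ℝ H) (l : w → ℝ) (γ m : ℝ),
      (∀ i, P (φ i) = l i • φ i) ∧ (Summable fun i => (l i - γ) ^ 2) ∧
        0 < m ∧ (∀ i, m ≤ l i) ∧ m ≤ γ := by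
  obtain ⟨hS, -, m, hm, hpos⟩ := hP
  obtain ⟨w, φ, l, γ, hl, hsum⟩ := exists_diagonal_of_mem_SymHSX hS
  have hml : ∀ i, m ≤ l i := fun i => by
    simpa [hl, inner_smul_right, φ.orthonormal.1 i] using hpos (φ i)
  refine ⟨w, φ, l, γ, m, hl, hsum, hm, hml, ?_⟩
  -- If γ < m, infinitely many terms of a convergent series would be at least (m - γ)² > 0.
  by_contra! hγ
  have := infinite_of_hilbertBasis hH φ
  have h1 : Summable fun _ : w => (m - γ) ^ 2 :=
    Summable.of_nonneg_of_le (fun _ => sq_nonneg _)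
      (fun i => pow_le_pow_left₀ (by linarith) (by linarith [hml i]) 2) hsum
  exact pow_ne_zero 2 (sub_ne_zero.2 hγ.ne') ((summable_const_iff _).1 h1)

/-- This follows from log u ≤ u - 1 and supplies the Lipschitz constant needed by
`exists_diagonal_comp`. -/
theorem abs_log_sub_log_le {m x y : ℝ} (hm : 0 < m) (hx : m ≤ x) (hy : m ≤ y) :
    |Real.log x - Real.log y| ≤ m⁻¹ * |x - y| := by
  have key : ∀ a b : ℝ, m ≤ a → m ≤ b → Real.log a - Real.log b ≤ m⁻¹ * |a - b| := by
    intro a b ha hb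
    have ha0 := hm.trans_le ha
    have hb0 := hm.trans_le hb
    rw [← Real.log_div ha0.ne' hb0.ne']
    calc Real.log (a / b) ≤ a / b - 1 := Real.log_le_sub_one_of_pos (div_pos ha0 hb0)
      _ = b⁻¹ * (a - b) := by field_simp
      _ ≤ b⁻¹ * |a - b| := mul_le_mul_of_nonneg_left (le_abs_self _) (inv_pos.2 hb0).le
      _ ≤ m⁻¹ * |a - b| := mul_le_mul_of_nonneg_right (inv_anti₀ hm hb) (abs_nonneg _)
  exact abs_sub_le_iff.2 ⟨key x y hx hy, abs_sub_comm x y ▸ key y x hy hx⟩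

theorem abs_inv_sub_inv_le {m x y : ℝ} (hm : 0 < m) (hx : m ≤ x) (hy : m ≤ y) :
    |x⁻¹ - y⁻¹| ≤ (m * m)⁻¹ * |x - y| := by
  have hx0 := hm.trans_le hx
  have hy0 := hm.trans_le hy
  have h : x⁻¹ - y⁻¹ = (x * y)⁻¹ * (y - x) := by field_simp
  rw [h, abs_mul, abs_of_pos (inv_pos.2 (mul_pos hx0 hy0)), abs_sub_comm]
  exact mul_le_mul_of_nonneg_right
    (inv_anti₀ (mul_pos hm hm) (mul_le_mul hx hy hm.le hx0.le)) (abs_nonneg _)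

theorem abs_exp_sub_exp_le {R x y : ℝ} (hx : x ≤ R) (hy : y ≤ R) :
    |Real.exp x - Real.exp y| ≤ Real.exp R * |x - y| := by
  have key : ∀ a b : ℝ, a ≤ R → Real.exp a - Real.exp b ≤ Real.exp R * |a - b| := by
    intro a b ha
    calc Real.exp a - Real.exp b = Real.exp a * (1 - Real.exp (b - a)) := by
          rw [mul_sub, ← Real.exp_add, mul_one, add_sub_cancel]
      _ ≤ Real.exp a * (a - b) := mul_le_mul_of_nonneg_left
          (by linarith [Real.add_one_le_exp (b - a)]) (Real.exp_pos a).le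
      _ ≤ Real.exp a * |a - b| := mul_le_mul_of_nonneg_left (le_abs_self _) (Real.exp_pos a).le
      _ ≤ Real.exp R * |a - b| := mul_le_mul_of_nonneg_right (Real.exp_le_exp.2 ha) (abs_nonneg _)
  exact abs_sub_le_iff.2 ⟨key x y hx, abs_sub_comm x y ▸ key y x hy⟩

theorem isPrincipalLog_opLog (hH : ¬ FiniteDimensional ℝ H) {P : H →L[ℝ] H} (hP : P ∈ PC2 H) :
    IsPrincipalLog P (opLog P) ∧ opLog P ∈ SymHSX H := by
  obtain ⟨w, φ, l, γ, m, hl, hsum, hm, hml, hmγ⟩ := exists_diagonal_of_mem_PC2 hH hP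
  obtain ⟨L, hL, hLl⟩ := exists_diagonal_comp φ hsum Real.log
    fun i => abs_log_sub_log_le hm (hml i) hmγ
  have h : IsPrincipalLog P L := ⟨w, φ, l, fun i => ⟨hm.trans_le (hml i), hl i, hLl i⟩⟩
  rw [h.opLog_eq]
  exact ⟨h, hL⟩

theorem inverse_mem_PC2 (hH : ¬ FiniteDimensional ℝ H) {P : H →L[ℝ] H} (hP : P ∈ PC2 H) :
    IsUnit P ∧ Ring.inverse P ∈ PC2 H ∧ opLog (Ring.inverse P) = -opLog P := by
  obtain ⟨w, φ, l, γ, m, hl, hsum, hm, hml, hmγ⟩ := exists_diagonal_of_mem_PC2 hH hP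
  obtain ⟨S, hS, hSl⟩ := exists_diagonal_comp φ hsum (fun x => x⁻¹)
    fun i => abs_inv_sub_inv_le hm (hml i) hmγ
  have hl0 : ∀ i, 0 < l i := fun i => hm.trans_le (hml i)
  have hPS : P * S = 1 := ext_hilbertBasis φ fun i => by
    change P (S (φ i)) = φ i
    rw [hSl, map_smul, hl, smul_smul, inv_mul_cancel₀ (hl0 i).ne', one_smul]
  have hSP : S * P = 1 := ext_hilbertBasis φ fun i => by
    change S (P (φ i)) = φ i
    rw [hl, map_smul, hSl, smul_smul, mul_inv_cancel₀ (hl0 i).ne', one_smul]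
  let u : (H →L[ℝ] H)ˣ := ⟨P, S, hPS, hSP⟩
  have hinv : Ring.inverse P = S := Ring.inverse_unit u
  rw [hinv]
  refine ⟨u.isUnit, ⟨hS, ?_⟩, ?_⟩
  · obtain ⟨R, hR⟩ := exists_abs_le_of_summable_sq hsum
    -- An upper bound for the eigenvalues of P, inverted, is a lower bound for those of its inverse.
    have hpos : 0 < |R| + γ := add_pos_of_nonneg_of_pos (abs_nonneg R) (hm.trans_le hmγ)
    refine isPosDefOp_of_diagonal hSl (inv_pos.2 hpos) fun i => inv_anti₀ (hl0 i) ?_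
    linarith [(le_abs_self _).trans (hR i), le_abs_self R]
  · have hlog := (isPrincipalLog_opLog hH hP).1
    refine IsPrincipalLog.opLog_eq ⟨w, φ, fun i => (l i)⁻¹, fun i =>
      ⟨inv_pos.2 (hl0 i), hSl i, ?_⟩⟩
    rw [neg_apply, hlog.apply_eq (hl i), Real.log_inv, neg_smul]

theorem exp_mem_PC2 {L : H →L[ℝ] H} (hL : L ∈ SymHSX H) :
    NormedSpace.exp L ∈ PC2 H ∧ opLog (NormedSpace.exp L) = L := by
  obtain ⟨w, φ, t, γ, ht, hsum⟩ := exists_diagonal_of_mem_SymHSX hL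
  have hexp : ∀ i, NormedSpace.exp L (φ i) = Real.exp (t i) • φ i := fun i =>
    exp_apply_eigenvector (ht i)
  obtain ⟨R, hR⟩ := exists_abs_le_of_summable_sq hsum
  -- The absolute value is needed because the index set may be empty here, leaving the sign of R
  -- unknown, and the bound must also dominate γ.
  have hup : ∀ i, t i ≤ |R| + γ := fun i => by
    linarith [(le_abs_self _).trans (hR i), le_abs_self R]
  have hlow : ∀ i, γ - R ≤ t i := fun i => by
    linarith [neg_le_of_abs_le (hR i)]
  refine ⟨⟨mem_SymHSX_of_diagonal hexp (γ := Real.exp γ) (summable_sq_of_abs_le hsum fun i =>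
    abs_exp_sub_exp_le (hup i) (by linarith [abs_nonneg R])),
    isPosDefOp_of_diagonal hexp (Real.exp_pos (γ - R)) fun i => Real.exp_le_exp.2 (hlow i)⟩, ?_⟩
  refine IsPrincipalLog.opLog_eq ⟨w, φ, fun i => Real.exp (t i), fun i =>
    ⟨Real.exp_pos _, hexp i, ?_⟩⟩
  rw [ht, Real.log_exp]

theorem opLog_odot (hH : ¬ FiniteDimensional ℝ H) {P Q : H →L[ℝ] H} (hP : P ∈ PC2 H)
    (hQ : Q ∈ PC2 H) : odot P Q ∈ PC2 H ∧ opLog (odot P Q) = opLog P + opLog Q :=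
  exp_mem_PC2 (add_mem_SymHSX (isPrincipalLog_opLog hH hP).2 (isPrincipalLog_opLog hH hQ).2)

theorem logHSNorm_odot_inverse (hH : ¬ FiniteDimensional ℝ H) {P Q : H →L[ℝ] H}
    (hP : P ∈ PC2 H) (hQ : Q ∈ PC2 H) :
    logHSNorm (odot P (Ring.inverse Q)) = hsxNorm (opLog P - opLog Q) := by
  obtain ⟨-, hQ', hlog⟩ := inverse_mem_PC2 hH hQ
  rw [logHSNorm, logHSInner, (opLog_odot hH hP hQ').2, hlog, ← sub_eq_add_neg, hsxNorm]

theorem one_mem_PC2 : (1 : H →L[ℝ] H) ∈ PC2 H := by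
  refine ⟨⟨0, 1, IsSelfAdjoint.zero _, ?_, by simp⟩, IsSelfAdjoint.one _, 1, one_pos, fun x => ?_⟩
  · simp [IsHilbertSchmidt]
  · simp

end LogHilbertSchmidt

end LogHS

theorem theorem3p6 {H : Type*} [NormedAddCommGroup H] [InnerProductSpace ℝ H] [CompleteSpace H]
    [TopologicalSpace.SeparableSpace H] (hH : ¬ FiniteDimensional ℝ H) :
    -- the objects are well defined: the logarithm maps `PC₂(H)` into `Sym(H) ∩ HS_X(H)`, and
    -- `PC₂(H)` is stable under inverses and `⊙`
    (∀ P ∈ PC2 H, IsPrincipalLog P (opLog P) ∧ opLog P ∈ SymHSX H) ∧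
    (∀ P ∈ PC2 H, IsUnit P ∧ Ring.inverse P ∈ PC2 H) ∧
    (∀ P ∈ PC2 H, ∀ Q ∈ PC2 H, odot P Q ∈ PC2 H) ∧
    -- polynomial kernels
    (∀ (c : ℝ) (d : ℕ), 0 ≤ c →
      (∀ P Q : PC2 H, (logHSInner (P : H →L[ℝ] H) Q + c) ^ d
        = (c + hsxInner (opLog (P : H →L[ℝ] H)) (opLog (Q : H →L[ℝ] H))) ^ d) ∧
      IsPosDefKernel fun P Q : PC2 H =>
        (c + hsxInner (opLog (P : H →L[ℝ] H)) (opLog (Q : H →L[ℝ] H))) ^ d) ∧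
    -- generalized Gaussian kernels
    (∀ σ p : ℝ, σ ≠ 0 → 0 < p → p ≤ 2 →
      (∀ P Q : PC2 H,
        Real.exp (-(logHSNorm (odot (P : H →L[ℝ] H) (Ring.inverse (Q : H →L[ℝ] H))) ^ p) / σ ^ 2)
          = Real.exp (-(hsxNorm (opLog (P : H →L[ℝ] H) - opLog (Q : H →L[ℝ] H)) ^ p) / σ ^ 2)) ∧
      IsPosDefKernel fun P Q : PC2 H =>
        Real.exp (-(hsxNorm (opLog (P : H →L[ℝ] H) - opLog (Q : H →L[ℝ] H)) ^ p) / σ ^ 2)) := by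
  have hK : IsPosDefKernel fun P Q : PC2 H =>
      hsxInner (opLog (P : H →L[ℝ] H)) (opLog (Q : H →L[ℝ] H)) :=
    (isPosDefKernel_hsxInner hH).comp fun P : PC2 H =>
      (⟨opLog (P : H →L[ℝ] H), (isPrincipalLog_opLog hH P.2).2⟩ : SymHSX H)
  refine ⟨fun P hP => isPrincipalLog_opLog hH hP,
    fun P hP => ⟨(inverse_mem_PC2 hH hP).1, (inverse_mem_PC2 hH hP).2.1⟩,
    fun P hP Q hQ => (opLog_odot hH hP hQ).1, fun c d hc => ⟨fun P Q => ?_, ?_⟩,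
    fun σ p _ hp hp2 => ⟨fun P Q => ?_, ?_⟩⟩
  · rw [logHSInner, add_comm]
  · exact ((IsPosDefKernel.const hc).add hK).pow d
  · rw [logHSNorm_odot_inverse hH P.2 Q.2]
  · have : Nonempty (PC2 H) := ⟨⟨1, one_mem_PC2⟩⟩
    -- The p-th power of the norm is the squared distance to the power p/2, and p/2 lies in (0, 1].
    convert hK.exp_neg_sqDist_rpow (a := p / 2) (t := (σ ^ 2)⁻¹) (by linarith) (by linarith)
      (by positivity) using 4 with P Q
    rw [hsxNorm_sub hH (isPrincipalLog_opLog hH P.2).2 (isPrincipalLog_opLog hH Q.2).2,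
      Real.sqrt_eq_rpow, ← Real.rpow_mul (hK.sqDist_nonneg P Q), neg_div, div_eq_inv_mul,
      one_div_mul_eq_div]
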